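/- For a topological space $X$ let $\mathcal K(X)$ be the set of all compact subsets of $X$, and let $\operatorname{dens} X$ be the density of $X$, i.e. the least cardinality of a dense subset of $X$, with the usual convention that finite values are replaced by $\aleph_0$. Let $X$ and $Y$ be metrizable spaces and let $F\colon\mathcal K(X)\to\mathcal K(Y)$ be a map such that: - $(1)$ $F$ is monotone: if $K,L\in\mathcal K(X)$ and $K\subset L$, then $F(K)\subset F(L)$; - $(2)_c$ for every countable $L\in\mathcal K(Y)$ there is $K\in\mathcal K(X)$ with $L\subset F(K)$; - $(3)_c$ if $U\subset X$ and $V\subset Y$ are non-empty open sets such that for each countable compact $L\subset V$ there is a compact $K\subset U$ with $L\subset F(K)$, then for every family $\mathcal W$ of open subsets of $X$ that covers $U$ and every point $y\in V$ there exist a finite subfamily $\mathcal E\subset\mathcal W$ and a neighborhood $V_y$ of $y$ such that for each countable compact $L\subset V_y$ there is a compact $K\subset\bigcup\mathcal E$ with $L\subset F(K)$. If $X$ is completely metrizable, then $Y$ is completely metrizable and $\operatorname{dens} Y\le\operatorname{dens} X$. -/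

import Mathlib

open TopologicalSpace Set Topology

universe u v

/-- The density of a topological space: the least cardinality of a dense subset. As is
customary for cardinal functions, finite values are replaced by `ℵ₀`. -/
noncomputable def dens (X : Type u) [TopologicalSpace X] : Cardinal.{u} :=
  max Cardinal.aleph0 (sInf {c : Cardinal.{u} | ∃ D : Set X, Dense D ∧ Cardinal.mk D = c})

section
variable {X : Type u} {Y : Type v} [TopologicalSpace X] [TopologicalSpace Y]

/-- Every countable compact `L ⊆ V` is contained in `F K` for some compact `K ⊆ U`. -/
def CountablyCovers (F : Compacts X → Compacts Y) (U : Set X) (V : Set Y) : Prop :=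
  ∀ L : Compacts Y, (L : Set Y).Countable → (L : Set Y) ⊆ V →
    ∃ K : Compacts X, (K : Set X) ⊆ U ∧ (L : Set Y) ⊆ (F K : Set Y)

/-- Every countable compact subset of `Y` is contained in some `F K`. -/
def CountablyCofinal (F : Compacts X → Compacts Y) : Prop :=
  ∀ L : Compacts Y, (L : Set Y).Countable → ∃ K : Compacts X, (L : Set Y) ⊆ (F K : Set Y)

/-- The local finite-subcover condition on `F`. An open cover of `U` is a family of open
subsets of `X` whose union contains `U`. -/
def LocalFiniteSubcover (F : Compacts X → Compacts Y) : Prop :=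
  ∀ (U : Set X) (V : Set Y), IsOpen U → U.Nonempty → IsOpen V → V.Nonempty →
    CountablyCovers F U V →
    ∀ W : Set (Set X), (∀ G ∈ W, IsOpen G) → U ⊆ ⋃₀ W →
    ∀ y ∈ V, ∃ E : Set (Set X), E ⊆ W ∧ E.Finite ∧
      ∃ Vy ∈ 𝓝 y, CountablyCovers F (⋃₀ E) Vy

end

/-!
To an open set `U` of `X` belongs the open region `coveredRegion F U` of the points of `Y` near which
all countable compact sets lie in some `F K` with `K ⊆ U`. Fix a complete metric on `X` and a base
`B` of cardinality at most `dens X`. By the local finite-subcover condition, the region of `U` is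
covered by the regions of finite unions of small members of `B` contained in `U`. Starting from
`U = X`, whose region is `Y`, and iterating with sizes `2⁻ⁿ`, one gets a tree of open subsets of `Y`.

This tree is complete along branches. If `y n` lies in the region of `U n`, then `y n ∈ F (K n)` for
some compact `K n ⊆ U n`; only singletons are used as countable compact sets here. As `U n` decreases
and is a finite union of sets of size `2⁻ⁿ`, the closure `C` of the union of all `K n` is compact, so
by monotonicity all `y n` lie in the compact set `F C` and have a cluster point
(`isCompleteSieve_coveredRegion`).

Both conclusions hold for every metrizable space with such a complete sieve:

* It is a `G_δ` in its completion, hence completely metrizable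
  (`IsCompleteSieve.isCompletelyMetrizableSpace`). Paracompactness provides point-finite refinements
  of the sieve in the completion, and König's lemma turns membership at every level into a branch.
* Its density is at most the number of nodes (`IsCompleteSieve.lift_dens_le`): by completeness, the
  sets along a branch can eventually be covered by finitely many balls of a given radius, so the
  centres of such finite nets, over all nodes and radii, form a dense set.
-/

open Filter

/-! ### Subspaces of type `G_δ` and point-finite refinements -/

section
variable {Y Z : Type*} [TopologicalSpace Y] [TopologicalSpace Z]

theorem isCompletelyMetrizableSpace_of_range_eq_iInter [IsCompletelyMetrizableSpace Z]
    {e : Y → Z} (he : IsEmbedding e) (O : ℕ → Opens Z) (hO : range e = ⋂ n, (O n : Set Z)) :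
    IsCompletelyMetrizableSpace Y := by
  let := upgradeIsCompletelyMetrizable Z
  have hmem : ∀ y n, e y ∈ O n := fun y n => mem_iInter.1 (hO ▸ mem_range_self y) n
  have (n : ℕ) : IsCompletelyMetrizableSpace (O n) :=
    inferInstanceAs (IsCompletelyMetrizableSpace (O n).CompleteCopy)
  -- The diagonal map into the product of the `O n` is a closed embedding.
  let f : Y → ∀ n, O n := fun y n => ⟨e y, hmem y n⟩
  have hf : IsEmbedding f := by
    refine .of_comp (continuous_pi fun n => he.continuous.subtype_mk _)
      (continuous_subtype_val.comp (continuous_apply 0)) ?_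
    exact he
  refine IsClosedEmbedding.IsCompletelyMetrizableSpace (f := f) ⟨hf, ?_⟩
  have : range f = {w | ∀ n, (w n : Z) = w 0} := by
    ext w
    constructor
    · rintro ⟨y, rfl⟩ n
      rfl
    · intro hw
      have : (w 0 : Z) ∈ range e := hO ▸ mem_iInter.2 fun n => hw n ▸ (w n).2
      obtain ⟨y, hy⟩ := this
      exact ⟨y, funext fun n => Subtype.ext (hy.trans (hw n).symm)⟩
  rw [this, ofPred_forall]
  exact isClosed_iInter fun n => isClosed_eq
    (continuous_subtype_val.comp (continuous_apply n))
    (continuous_subtype_val.comp (continuous_apply 0))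

/-- A family of open sets of a metrizable space has a point-finite open refinement with the same
union: the union is an open subspace, hence paracompact. -/
theorem exists_pointFinite_refinement [MetrizableSpace Z] {I : Type*} (u : I → Set Z)
    (hu : ∀ i, IsOpen (u i)) :
    ∃ v : I → Set Z, (∀ i, IsOpen (v i)) ∧ (∀ i, v i ⊆ u i) ∧ ⋃ i, u i ⊆ ⋃ i, v i ∧
      ∀ z, {i | z ∈ v i}.Finite := by
  let := metrizableSpaceMetric Z
  have hU : IsOpen (⋃ i, u i) := isOpen_iUnion hu
  obtain ⟨v, hvo, hvc, hvf, hvu⟩ := precise_refinement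
    (fun i => ((↑) : (⋃ i, u i : Set Z) → Z) ⁻¹' u i)
    (fun i => (hu i).preimage continuous_subtype_val)
    (eq_univ_of_forall fun z => by simpa only [← preimage_iUnion] using! z.2)
  refine ⟨fun i => (↑) '' v i, fun i => hU.isOpenMap_subtype_val _ (hvo i),
    fun i => image_subset_iff.2 (hvu i), fun z hz => ?_, fun z => ?_⟩
  · obtain ⟨i, hi⟩ := mem_iUnion.1 (hvc.symm ▸ mem_univ (⟨z, hz⟩ : (⋃ i, u i : Set Z)))
    exact mem_iUnion.2 ⟨i, _, hi, rfl⟩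
  · by_cases hz : z ∈ ⋃ i, u i
    · refine (hvf.point_finite ⟨z, hz⟩).subset ?_
      rintro i ⟨w, hw, rfl⟩
      exact hw
    · convert! finite_empty
      refine eq_empty_of_forall_notMem ?_
      rintro i ⟨w, -, rfl⟩
      exact hz w.2

end

/-! ### Complete sieves -/

/-- A complete sieve on `Y`: a family of open sets `V i`, indexed by the nodes `i : I` and
starting from `V r = univ`, in which every `V i` is covered at each stage `n` by the smaller sets
`V j` with `R n i j`, and such that along every branch `b` a sequence with `y n ∈ V (b n)` has a
cluster point. A branch is a sequence of nodes starting at `r` whose `n`-th step satisfies `R n`;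
the nodes are not required to remember their level, the relation `R` depends on it instead. -/
structure IsCompleteSieve {I Y : Type*} [TopologicalSpace Y] (R : ℕ → I → I → Prop)
    (V : I → Set Y) (r : I) : Prop where
  isOpen : ∀ i, IsOpen (V i)
  root : V r = univ
  anti : ∀ n i j, R n i j → V j ⊆ V i
  cover : ∀ n i, ∀ y ∈ V i, ∃ j, R n i j ∧ y ∈ V j
  exists_mapClusterPt : ∀ b : ℕ → I, b 0 = r → (∀ n, R n (b n) (b (n + 1))) →
    ∀ y : ℕ → Y, (∀ n, y n ∈ V (b n)) → ∃ a, MapClusterPt a atTop y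

namespace IsCompleteSieve

section
variable {I Y : Type*} [TopologicalSpace Y] {R : ℕ → I → I → Prop} {V : I → Set Y} {r : I}

theorem antitone_branch (h : IsCompleteSieve R V r) {b : ℕ → I}
    (hb : ∀ n, R n (b n) (b (n + 1))) : Antitone fun n => V (b n) :=
  antitone_nat_of_succ_le fun n => h.anti _ _ _ (hb n)

theorem exists_branch (h : IsCompleteSieve R V r) (y : Y) :
    ∃ b : ℕ → I, b 0 = r ∧ (∀ n, R n (b n) (b (n + 1))) ∧ ∀ n, y ∈ V (b n) := by
  choose g hgR hgV using h.cover
  let b : ℕ → {i // y ∈ V i} := fun n =>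
    Nat.rec ⟨r, h.root ▸ mem_univ y⟩ (fun n p => ⟨g n p.1 y p.2, hgV n p.1 y p.2⟩) n
  exact ⟨fun n => (b n).1, rfl, fun n => hgR n _ y (b n).2, fun n => (b n).2⟩

end

/-- König's lemma for a tree of finite sequences given by a family of sets `W t`: if `z` lies in
sets of every level and only in finitely many children of each node, it lies in all the sets
of a branch. Sequences are stored with the last entry first. -/
theorem exists_branch_of_finite {I Z : Type*} {W : List I → Set Z}
    (hW : ∀ j t, W (j :: t) ⊆ W t) {z : Z} (hz : ∀ n, ∃ t : List I, t.length = n ∧ z ∈ W t)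
    (hfin : ∀ t, {j | z ∈ W (j :: t)}.Finite) :
    ∃ t : ℕ → List I, t 0 = [] ∧ (∀ n, ∃ j, t (n + 1) = j :: t n) ∧ ∀ n, z ∈ W (t n) := by
  have happ : ∀ s t, W (s ++ t) ⊆ W t := by
    intro s t
    induction s with
    | nil => exact subset_rfl
    | cons j s ih => exact (hW j _).trans ih
  let P : List I → Prop := fun t => ∀ m, ∃ s : List I, s.length = m ∧ z ∈ W (s ++ t)
  have hP0 : P [] := by simpa [P] using hz
  have hPs : ∀ t, P t → ∃ j, P (j :: t) := by
    intro t ht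
    by_contra! hcon
    have : ∀ j, ∃ m, ∀ s : List I, s.length = m → z ∉ W (s ++ j :: t) := by
      simpa [P] using hcon
    choose m hm using this
    -- Beyond the maximum of the heights of the finitely many subtrees nothing is left.
    obtain ⟨M, hM⟩ := (((hfin t).image m)).bddAbove
    obtain ⟨s, hs, hzs⟩ := ht (M + 1)
    rcases s.eq_nil_or_concat with rfl | ⟨s', j, rfl⟩
    · simp at hs
    have hs' : s'.length = M := by simpa using hs
    have hzs' : z ∈ W (s' ++ j :: t) := by simpa using hzs
    have hj : m j ≤ M := hM ⟨j, happ _ _ hzs', rfl⟩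
    refine hm j (s'.drop (M - m j)) (by simp [hs']; omega) ?_
    rw [← List.take_append_drop (M - m j) s', List.append_assoc] at hzs'
    exact happ _ _ hzs'
  choose g hg using hPs
  let t : ℕ → {t // P t} := fun n => Nat.rec ⟨[], hP0⟩ (fun _ p => ⟨g p.1 p.2 :: p.1, hg _ _⟩) n
  refine ⟨fun n => (t n).1, rfl, fun n => ⟨g (t n).1 (t n).2, rfl⟩, fun n => ?_⟩
  obtain ⟨s, -, hs⟩ := (t n).2 0
  exact happ _ _ hs

variable {I Y : Type*} [TopologicalSpace Y] {R : ℕ → I → I → Prop} {V : I → Set Y} {r : I}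

/-- A metrizable space with a complete sieve is a `G_δ` in its completion. The sets of the sieve
are extended to open sets of the completion and refined so as to become point-finite among the
children of every node; a point of the completion that is covered at every level then lies on
a branch, by König's lemma, and completeness of the sieve puts it into the space. -/
theorem isCompletelyMetrizableSpace [MetrizableSpace Y] (h : IsCompleteSieve R V r) :
    IsCompletelyMetrizableSpace Y := by
  let := metrizableSpaceMetric Y
  let Z := UniformSpace.Completion Y
  let e : Y → Z := fun y => (y : UniformSpace.Completion Y)
  have he : IsEmbedding e := (UniformSpace.Completion.isUniformEmbedding_coe Y).isEmbedding
  have hd : DenseRange e := UniformSpace.Completion.denseRange_coe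
  choose O hO hOV using fun i => he.isInducing.isOpen_iff.1 (h.isOpen i)
  -- `v n i w j` is the part of the open set `w` assigned to the child `j` of the node `i`.
  choose v hvo hvu hvc hvf using fun n i (w : Opens Z) =>
    exists_pointFinite_refinement (fun j => {z | z ∈ w ∧ z ∈ O j ∧ R n i j}) fun j => by
      by_cases hR : R n i j
      · simpa [hR] using! w.isOpen.inter (hO j)
      · simp [hR]
  let W : List I → Opens Z := fun t =>
    List.rec ⊤ (fun j t w => ⟨v t.length (t.headD r) w j, hvo _ _ _ _⟩) t
  have hWu : ∀ j t z, z ∈ W (j :: t) → z ∈ W t ∧ z ∈ O j ∧ R t.length (t.headD r) j :=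
    fun j t z hz => hvu _ _ _ _ hz
  have hWV : ∀ t y, e y ∈ W t → y ∈ V (t.headD r) := by
    rintro (_ | ⟨j, t⟩) y hy
    · simp [h.root]
    · rw [List.headD_cons, ← hOV j]
      exact (hWu _ _ _ hy).2.1
  refine isCompletelyMetrizableSpace_of_range_eq_iInter he
    (fun n => ⨆ t : {t : List I // t.length = n}, W t.1) (Subset.antisymm ?_ ?_)
  · rintro _ ⟨y, rfl⟩
    suffices ∀ n, ∃ t : List I, t.length = n ∧ e y ∈ W t by simpa using this
    intro n
    induction n with
    | zero => exact ⟨[], rfl, trivial⟩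
    | succ n ih =>
      obtain ⟨t, rfl, ht⟩ := ih
      obtain ⟨j, hj, hyj⟩ := h.cover t.length _ _ (hWV t y ht)
      rw [← hOV j] at hyj
      obtain ⟨k, hk⟩ := mem_iUnion.1 (hvc t.length (t.headD r) (W t)
        (mem_iUnion.2 ⟨j, ht, hyj, hj⟩))
      exact ⟨k :: t, rfl, hk⟩
  · intro z hz
    have hz' : ∀ n, ∃ t : List I, t.length = n ∧ z ∈ W t := by simpa using hz
    obtain ⟨t, ht0, hts, htz⟩ := exists_branch_of_finite (W := fun t => (W t).carrier)
      (fun j t z hz => (hWu j t z hz).1) hz' (fun t => hvf t.length (t.headD r) (W t) z)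
    have hlen : ∀ n, (t n).length = n := by
      intro n
      induction n with
      | zero => simp [ht0]
      | succ n ih =>
        obtain ⟨j, hj⟩ := hts n
        simp [hj, ih]
    have hR : ∀ n, R n ((t n).headD r) ((t (n + 1)).headD r) := by
      intro n
      obtain ⟨j, hj⟩ := hts n
      have := (hWu j (t n) z (hj ▸ htz (n + 1))).2.2
      rw [hj]
      rwa [hlen n] at this
    have hy : ∀ n : ℕ, ∃ y, e y ∈ W (t n) ∧ dist (e y) z < 1 / ((n : ℝ) + 1) := by
      intro n
      obtain ⟨y, hy⟩ := hd.exists_mem_open ((W (t n)).isOpen.inter Metric.isOpen_ball)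
        ⟨z, htz n, Metric.mem_ball_self (Nat.one_div_pos_of_nat (α := ℝ) (n := n))⟩
      exact ⟨y, hy.1, hy.2⟩
    choose y hyW hyz using hy
    obtain ⟨a, ha⟩ := h.exists_mapClusterPt (fun n => (t n).headD r) (by simp [ht0]) hR y
      fun n => hWV _ _ (hyW n)
    have hlim : Tendsto (e ∘ y) atTop (𝓝 z) :=
      tendsto_iff_dist_tendsto_zero.2 (squeeze_zero (fun _ => dist_nonneg) (fun n => (hyz n).le)
        tendsto_one_div_add_atTop_nhds_zero_nat)
    have hea : MapClusterPt (e a) atTop (e ∘ y) := ha.tendsto_comp (he.continuous.tendsto a)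
    exact ⟨a, eq_of_nhds_neBot (hea.clusterPt.neBot.mono (inf_le_inf_left _ hlim))⟩

/-- Along a branch of a complete sieve the sets can eventually be covered by finitely many balls
of a given radius: otherwise they would contain the terms of a separated sequence. -/
theorem exists_finite_cover_balls {Y : Type*} [MetricSpace Y] {V : I → Set Y}
    (h : IsCompleteSieve R V r) {b : ℕ → I} (hb0 : b 0 = r)
    (hb : ∀ n, R n (b n) (b (n + 1))) {ε : ℝ} (hε : 0 < ε) :
    ∃ n, ∃ s : Finset Y, V (b n) ⊆ ⋃ x ∈ s, Metric.ball x ε := by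
  classical
  by_contra! hcon
  obtain ⟨f, hfV, hfd⟩ := exists_seq_of_forall_finset_exists
    (fun p : ℕ × Y => p.2 ∈ V (b p.1)) (fun p q => p.1 < q.1 ∧ ε ≤ dist q.2 p.2) (by
      intro s _
      obtain ⟨y, hyV, hy⟩ := not_subset.1 (hcon (s.sup Prod.fst + 1) (s.image Prod.snd))
      refine ⟨(_, y), hyV, fun p hp => ⟨Nat.lt_succ_of_le (Finset.le_sup hp), ?_⟩⟩
      by_contra! hlt
      exact hy (mem_biUnion (Finset.mem_coe.2 (Finset.mem_image_of_mem _ hp)) hlt))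
  have hmono : StrictMono fun n => (f n).1 := fun m n hmn => (hfd m n hmn).1
  obtain ⟨a, ha⟩ := h.exists_mapClusterPt b hb0 hb (fun n => (f n).2)
    fun n => h.antitone_branch hb (hmono.id_le n) (hfV n)
  have hfr := mapClusterPt_iff_frequently.1 ha _ (Metric.ball_mem_nhds a (half_pos hε))
  obtain ⟨m, -, hm⟩ := frequently_atTop.1 hfr 0
  obtain ⟨n, hmn, hn⟩ := frequently_atTop.1 hfr (m + 1)
  have := (hfd m n hmn).2
  have := dist_triangle_right (f n).2 (f m).2 a
  rw [Metric.mem_ball] at hm hn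
  linarith

end IsCompleteSieve

/-! ### Density -/

theorem dens_le_of_dense {X : Type u} [TopologicalSpace X] {D : Set X} (hD : Dense D) :
    dens X ≤ max Cardinal.aleph0 (Cardinal.mk D) :=
  max_le_max le_rfl (csInf_le' ⟨D, hD, rfl⟩)

theorem exists_isTopologicalBasis_mk_le_dens (X : Type u) [TopologicalSpace X]
    [MetrizableSpace X] :
    ∃ B : Set (Set X), IsTopologicalBasis B ∧ Cardinal.mk B ≤ dens X := by
  let := metrizableSpaceMetric X
  obtain ⟨D, hD, hDc⟩ : sInf {c : Cardinal.{u} | ∃ D : Set X, Dense D ∧ Cardinal.mk D = c} ∈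
      {c : Cardinal.{u} | ∃ D : Set X, Dense D ∧ Cardinal.mk D = c} :=
    csInf_mem ⟨_, univ, dense_univ, rfl⟩
  refine ⟨range fun p : D × ℕ => Metric.ball (p.1 : X) (1 / ((p.2 : ℝ) + 1)), ?_, ?_⟩
  · refine isTopologicalBasis_of_isOpen_of_nhds ?_ fun x U hx hU => ?_
    · rintro _ ⟨p, rfl⟩
      exact Metric.isOpen_ball
    · obtain ⟨ε, hε, hεU⟩ := Metric.isOpen_iff.1 hU x hx
      obtain ⟨n, hn⟩ := exists_nat_one_div_lt (half_pos hε)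
      obtain ⟨d, hd, hdx⟩ := hD.exists_dist_lt x (Nat.one_div_pos_of_nat (α := ℝ) (n := n))
      refine ⟨_, ⟨(⟨d, hd⟩, n), rfl⟩, hdx, fun y hy => hεU ?_⟩
      have := dist_triangle_right y x d
      rw [Metric.mem_ball] at hy ⊢
      linarith
  · refine Cardinal.mk_range_le.trans ?_
    rw [Cardinal.mk_prod, Cardinal.lift_uzero, Cardinal.mk_nat, Cardinal.lift_aleph0, hDc]
    refine (Cardinal.mul_le_max _ _).trans (max_le (max_le ?_ ?_) ?_)
    · exact le_max_right _ _
    · exact le_max_left _ _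
    · exact le_max_left _ _

theorem IsCompleteSieve.lift_dens_le {I : Type u} {Y : Type v} [TopologicalSpace Y]
    [MetrizableSpace Y] {R : ℕ → I → I → Prop} {V : I → Set Y} {r : I}
    (h : IsCompleteSieve R V r) :
    Cardinal.lift.{u} (dens Y) ≤ Cardinal.lift.{v} (max Cardinal.aleph0 (Cardinal.mk I)) := by
  let := metrizableSpaceMetric Y
  -- `s p` is a finite net of radius `1 / (p.2 + 1)` for `V p.1`, if there is one.
  have hs : ∀ p : I × ℕ, ∃ s : Finset Y,
      (∃ s' : Finset Y, V p.1 ⊆ ⋃ x ∈ s', Metric.ball x (1 / ((p.2 : ℝ) + 1))) →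
        V p.1 ⊆ ⋃ x ∈ s, Metric.ball x (1 / ((p.2 : ℝ) + 1)) := fun p => by
    by_cases hp : ∃ s' : Finset Y, V p.1 ⊆ ⋃ x ∈ s', Metric.ball x (1 / ((p.2 : ℝ) + 1))
    · exact hp.imp fun s hs _ => hs
    · exact ⟨∅, fun h => absurd h hp⟩
  choose s hs using hs
  have hD : Dense (⋃ p, (s p : Set Y)) := by
    refine Metric.dense_iff.2 fun y ε hε => ?_
    obtain ⟨m, hm⟩ := exists_nat_one_div_lt hε
    obtain ⟨b, hb0, hb, hyb⟩ := h.exists_branch y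
    obtain ⟨n, hn⟩ := h.exists_finite_cover_balls hb0 hb
      (Nat.one_div_pos_of_nat (α := ℝ) (n := m))
    obtain ⟨x, hx, hyx⟩ := mem_iUnion₂.1 (hs (b n, m) hn (hyb n))
    exact ⟨x, (Metric.mem_ball'.1 hyx).trans hm, mem_iUnion.2 ⟨_, hx⟩⟩
  have hc : Cardinal.lift.{u} (Cardinal.mk (⋃ p, (s p : Set Y))) ≤
      Cardinal.lift.{v} (max Cardinal.aleph0 (Cardinal.mk I)) := by
    refine (Cardinal.mk_iUnion_le_lift _).trans ?_
    have h1 : ⨆ p, Cardinal.lift.{u} (Cardinal.mk (s p : Set Y)) ≤ Cardinal.aleph0 :=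
      ciSup_le' fun p => by simp
    refine (mul_le_mul' le_rfl h1).trans ?_
    rw [Cardinal.mk_prod, Cardinal.lift_uzero, Cardinal.mk_nat, Cardinal.lift_aleph0]
    simp only [Cardinal.lift_mul, Cardinal.lift_aleph0, Cardinal.lift_max, mul_assoc,
      Cardinal.aleph0_mul_aleph0]
    exact (Cardinal.mul_le_max _ _).trans (max_le (max_comm _ _).le (le_max_left _ _))
  refine (Cardinal.lift_le.2 (dens_le_of_dense hD)).trans ?_
  rw [Cardinal.lift_max]
  refine max_le ?_ hc
  simp

/-! ### Regions of `Y` dominated by open sets of `X` -/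

section
variable {X : Type u} {Y : Type v} [TopologicalSpace X] [TopologicalSpace Y]

theorem CountablyCovers.mono {F : Compacts X → Compacts Y} {U U' : Set X} {V V' : Set Y}
    (h : CountablyCovers F U V) (hU : U ⊆ U') (hV : V' ⊆ V) : CountablyCovers F U' V' :=
  fun L hL hLV => (h L hL (hLV.trans hV)).imp fun _ hK => ⟨hK.1.trans hU, hK.2⟩

/-- The set of points of `Y` having an open neighbourhood all of whose countable compact subsets
lie in some `F K` with `K ⊆ U`. Taking the union of all such neighbourhoods, rather than choosing
one, leaves a single region for each `U`; this is what makes the sieve below small enough to bound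
the density of `Y`. -/
def coveredRegion (F : Compacts X → Compacts Y) (U : Set X) : Set Y :=
  ⋃₀ {V | IsOpen V ∧ CountablyCovers F U V}

variable {F : Compacts X → Compacts Y}

theorem isOpen_coveredRegion (F : Compacts X → Compacts Y) (U : Set X) :
    IsOpen (coveredRegion F U) :=
  isOpen_sUnion fun _ hV => hV.1

theorem coveredRegion_mono {U U' : Set X} (h : U ⊆ U') :
    coveredRegion F U ⊆ coveredRegion F U' :=
  sUnion_subset_sUnion fun _ hV => ⟨hV.1, hV.2.mono h subset_rfl⟩

theorem CountablyCofinal.coveredRegion_univ (h : CountablyCofinal F) :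
    coveredRegion F univ = univ :=
  eq_univ_of_univ_subset (subset_sUnion_of_mem ⟨isOpen_univ, fun L hL _ =>
    (h L hL).imp fun _ hK => ⟨subset_univ _, hK⟩⟩)

theorem exists_compacts_of_mem_coveredRegion {U : Set X} {y : Y} (hy : y ∈ coveredRegion F U) :
    ∃ K : Compacts X, (K : Set X) ⊆ U ∧ y ∈ F K := by
  obtain ⟨V, ⟨-, hV⟩, hyV⟩ := hy
  obtain ⟨K, hKU, hK⟩ := hV {y} (by simp) (by simpa using hyV)
  exact ⟨K, hKU, hK (by simp)⟩

theorem LocalFiniteSubcover.exists_mem_coveredRegion (h : LocalFiniteSubcover F) {U : Set X}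
    (hU : IsOpen U) {y : Y} (hy : y ∈ coveredRegion F U) {W : Set (Set X)}
    (hW : ∀ G ∈ W, IsOpen G) (hUW : U ⊆ ⋃₀ W) :
    ∃ E ⊆ W, E.Finite ∧ y ∈ coveredRegion F (⋃₀ E) := by
  rcases U.eq_empty_or_nonempty with rfl | hne
  · exact ⟨∅, empty_subset _, finite_empty, by simpa using hy⟩
  obtain ⟨V, ⟨hVo, hV⟩, hyV⟩ := hy
  obtain ⟨E, hEW, hE, V', hV', hEV'⟩ := h U V hU hne hVo ⟨y, hyV⟩ hV W hW hUW y hyV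
  exact ⟨E, hEW, hE, interior V', ⟨isOpen_interior, hEV'.mono subset_rfl interior_subset⟩,
    mem_interior_iff_mem_nhds.2 hV'⟩

end

/-! ### The sieve induced by `F` -/

theorem isCompact_closure_iUnion_of_small {X : Type*} [MetricSpace X] [CompleteSpace X]
    {U K : ℕ → Set X} (hU : Antitone U)
    (hsmall : ∀ ε > 0, ∃ n, ∃ s : Set X, s.Finite ∧ U n ⊆ ⋃ x ∈ s, Metric.ball x ε)
    (hK : ∀ n, IsCompact (K n)) (hKU : ∀ n, K n ⊆ U n) : IsCompact (closure (⋃ n, K n)) := by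
  refine isCompact_iff_totallyBounded_isComplete.2
    ⟨TotallyBounded.closure ?_, isClosed_closure.isComplete⟩
  refine Metric.totallyBounded_iff.2 fun ε hε => ?_
  obtain ⟨n, s, hs, hns⟩ := hsmall ε hε
  obtain ⟨t, ht, hnt⟩ := Metric.totallyBounded_iff.1
    ((finite_Iio n).isCompact_biUnion fun m _ => hK m).totallyBounded ε hε
  refine ⟨s ∪ t, hs.union ht, iUnion_subset fun m => ?_⟩
  rw [biUnion_union]
  rcases lt_or_ge m n with hm | hm
  · exact (subset_biUnion_of_mem (u := K) (mem_Iio.2 hm)).trans (hnt.trans subset_union_right)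
  · exact (hKU m).trans ((hU hm).trans (hns.trans subset_union_left))

section
variable {X : Type u} [MetricSpace X] {B : Set (Set X)}

/-- The open set coded by a node: the union of a finite list of members of `B`, or the whole space
for the root `none`. -/
def nodeSet : Option (List B) → Set X
  | none => univ
  | some l => ⋃ b ∈ l, (b : Set X)

/-- The node `j` is a child of `i` at stage `n` if it is a list of sets contained in the open set
of `i` and in balls of radius `2⁻ⁿ`. -/
def IsSmallChild (n : ℕ) (i j : Option (List B)) : Prop :=
  ∃ l : List B, j = some l ∧
    ∀ b ∈ l, (b : Set X) ⊆ nodeSet i ∧ ∃ x, (b : Set X) ⊆ Metric.ball x ((1 / 2) ^ n)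

theorem IsSmallChild.nodeSet_subset {n : ℕ} {i j : Option (List B)} (h : IsSmallChild n i j) :
    nodeSet j ⊆ nodeSet i := by
  obtain ⟨l, rfl, hl⟩ := h
  exact iUnion₂_subset fun b hb => (hl b hb).1

theorem IsSmallChild.exists_cover {n : ℕ} {i j : Option (List B)} (h : IsSmallChild n i j) :
    ∃ s : Set X, s.Finite ∧ nodeSet j ⊆ ⋃ x ∈ s, Metric.ball x ((1 / 2) ^ n) := by
  obtain ⟨l, rfl, hl⟩ := h
  choose c hc using fun b : {b // b ∈ l} => (hl b b.2).2
  have := l.finite_toSet.to_subtype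
  exact ⟨range c, finite_range c, iUnion₂_subset fun b hb => (hc ⟨b, hb⟩).trans
    (subset_biUnion_of_mem (u := fun x => Metric.ball x ((1 / 2) ^ n)) (mem_range_self _))⟩

theorem isOpen_nodeSet (hB : IsTopologicalBasis B) (i : Option (List B)) :
    IsOpen (nodeSet i) := by
  cases i with
  | none => exact isOpen_univ
  | some l => exact isOpen_biUnion fun b _ => hB.isOpen b.2

/-- The regions covered by finite unions of basic open sets form a complete sieve on `Y`. Given
`y n` in the regions along a branch, pick compact sets `K n` in the corresponding open sets of `X`
with `y n ∈ F (K n)`. Since these open sets get small, the union of the `K n` is relatively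
compact, and by monotonicity all `y n` lie in the image under `F` of its closure. -/
theorem isCompleteSieve_coveredRegion [CompleteSpace X] {Y : Type v} [TopologicalSpace Y]
    {F : Compacts X → Compacts Y} (h1 : Monotone F) (h2 : CountablyCofinal F)
    (h3 : LocalFiniteSubcover F) (hB : IsTopologicalBasis B) :
    IsCompleteSieve IsSmallChild (fun i : Option (List B) => coveredRegion F (nodeSet i)) none where
  isOpen _ := isOpen_coveredRegion F _
  root := h2.coveredRegion_univ
  anti _ _ _ h := coveredRegion_mono h.nodeSet_subset
  cover n i y hy := by
    obtain ⟨E, hEW, hE, hyE⟩ := h3.exists_mem_coveredRegion (isOpen_nodeSet hB i) hy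
      (W := {b ∈ B | b ⊆ nodeSet i ∧ ∃ x, b ⊆ Metric.ball x ((1 / 2) ^ n)})
      (fun b hb => hB.isOpen hb.1) fun x hx => by
        obtain ⟨b, hb, hxb, hbs⟩ := hB.exists_subset_of_mem_open
          (u := nodeSet i ∩ Metric.ball x ((1 / 2) ^ n)) ⟨hx, Metric.mem_ball_self (by positivity)⟩
          ((isOpen_nodeSet hB i).inter Metric.isOpen_ball)
        exact ⟨b, ⟨hb, hbs.trans inter_subset_left, x, hbs.trans inter_subset_right⟩, hxb⟩
    have hfin : ((↑) ⁻¹' E : Set B).Finite := hE.preimage Subtype.val_injective.injOn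
    refine ⟨some hfin.toFinset.toList, ⟨_, rfl, fun b hb => ?_⟩, coveredRegion_mono ?_ hyE⟩
    · exact (hEW (by simpa using hb)).2
    · exact fun x ⟨b, hb, hx⟩ => mem_iUnion₂.2 ⟨⟨b, (hEW hb).1⟩, by simpa using hb, hx⟩
  exists_mapClusterPt b _ hb y hy := by
    choose K hKU hyK using fun n => exists_compacts_of_mem_coveredRegion (hy n)
    have hK : IsCompact (closure (⋃ n, (K n : Set X))) := by
      refine isCompact_closure_iUnion_of_small (U := fun n => nodeSet (b n))
        (antitone_nat_of_succ_le fun n => (hb n).nodeSet_subset) (fun ε hε => ?_)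
        (fun n => (K n).isCompact) hKU
      obtain ⟨n, hn⟩ := exists_pow_lt_of_lt_one hε (one_half_lt_one (α := ℝ))
      obtain ⟨s, hs, hns⟩ := (hb n).exists_cover
      exact ⟨n + 1, s, hs, hns.trans (iUnion₂_mono fun x _ => Metric.ball_subset_ball hn.le)⟩
    let C : Compacts X := ⟨_, hK⟩
    have hyC : ∀ n, y n ∈ (F C : Set Y) := fun n =>
      h1 (show K n ≤ C from
        (subset_iUnion (fun n => (K n : Set X)) n).trans subset_closure) (hyK n)
    obtain ⟨a, -, ha⟩ := (F C).isCompact (f := map y atTop)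
      (tendsto_principal.2 (Eventually.of_forall hyC))
    exact ⟨a, ha⟩

end

theorem theorem1p2 {X : Type u} {Y : Type v} [TopologicalSpace X] [TopologicalSpace Y]
    [MetrizableSpace X] [MetrizableSpace Y]
    (F : Compacts X → Compacts Y)
    (h1 : Monotone F)
    (h2 : CountablyCofinal F)
    (h3 : LocalFiniteSubcover F)
    (hX : IsCompletelyMetrizableSpace X) :
    IsCompletelyMetrizableSpace Y ∧
      Cardinal.lift.{u} (dens Y) ≤ Cardinal.lift.{v} (dens X) := by
  obtain ⟨B, hB, hBX⟩ := exists_isTopologicalBasis_mk_le_dens X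
  let := upgradeIsCompletelyMetrizable X
  have hS := isCompleteSieve_coveredRegion h1 h2 h3 hB
  refine ⟨hS.isCompletelyMetrizableSpace, hS.lift_dens_le.trans (Cardinal.lift_le.2 ?_)⟩
  have hX0 : Cardinal.aleph0 ≤ dens X := le_max_left _ _
  refine max_le hX0 ?_
  rw [Cardinal.mk_option]
  exact Cardinal.add_le_of_le hX0 ((Cardinal.mk_list_le_max _).trans (max_le hX0 hBX))
    (Cardinal.one_le_aleph0.trans hX0)
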